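/- Write $e(x)=\exp(2\pi i x)$. For $\nu\in\mathbb{R}$, $m\in\mathbb{Z}$ and $z\in\mathbb{C}^{\times}$ let $\chi_{i\nu,m}(z)=|z|^{2i\nu}(z/|z|)^m$, and let $d\mu(\nu,m)$ be the product of Lebesgue measure on $\mathbb{R}$ and counting measure on $\mathbb{Z}$. For $f\in C_c^\infty(\mathbb{C}^\times)$ let $$\breve f(\nu,m)=\int_{\mathbb{C}^\times} f(z)\,\chi_{i\nu,m}(z)\,d^\times z,\qquad d^\times z=\frac{2\,dx\,dy}{|z|^2}\quad(z=x+iy).$$ Fix a smooth function $v:(0,\infty)\to\mathbb{R}$ with $v\equiv 1$ on $[1/2,2]$ and $v\equiv 0$ on $(0,1/3]\cup[3,\infty)$. For $R>0$ define $\xi_R(\nu,m)$ by letting $\xi_R(2\nu,m)$ be $\frac{1}{4\pi^2}$ times the Mellin transform at $(\nu,m)$ of $z\mapsto v(|z|/R)\,e(2\operatorname{Re} z)$. **Lemma.** There are constants $0<c_1<c_2$, depending only on $v$, such that for every $R_0>1$ the following hold. (1) For all $R\ge R_0$ and all $z\in\mathbb{C}$ with $|z|\in[R/2,2R]$, $$e(2\operatorname{Re}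 z)=\iint_{\mathbb{R}\times\mathbb{Z}}\xi_R(2\nu,m)\,\overline{\chi_{i\nu,m}(z)}\,d\mu(\nu,m),$$ where the integral converges absolutely. (2) For every real $A$ there is a constant $C$ depending only on $A$, $R_0$ and $v$ such that $|\xi_R(\nu,m)|\le C\,(R+|\nu|+|m|)^{-A}$ for all $R\ge R_0$, $\nu\in\mathbb{R}$ and $m\in\mathbb{Z}$, unless $c_1R\le\sqrt{\nu^2+m^2}\le c_2R$. (3) There is a constant $C$ depending only on $R_0$ and $v$ such that $|\xi_R(\nu,m)|\le C\,\dfrac{\log R}{R}$ for all $R\ge R_0$, $\nu\in\mathbb{R}$ and $m\in\mathbb{Z}$ with $c_1R\le\sqrt{\nu^2+m^2}\le c_2R$. -/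

import Mathlib

open MeasureTheory Set
open scoped ContDiff

noncomputable section

namespace ComplexMellin

/-- The additive exponential `e(x) = exp(2 π i x)`. -/
def e (x : ℝ) : ℂ := Complex.exp (2 * Real.pi * Complex.I * x)

/-- The unitary character `χ_{iν,m}(z) = |z|^{2iν} (z/|z|)^m` of `ℂˣ`. -/
def char (ν : ℝ) (m : ℤ) (z : ℂ) : ℂ :=
  (‖z‖ : ℂ) ^ (2 * Complex.I * (ν : ℂ)) * (z / (‖z‖ : ℂ)) ^ m

/-- The Mellin transform of a function on `ℂˣ`, with respect to the Haar measure
`d^×z = dz / |z|^2`, where `dz` is twice the Lebesgue measure of the plane. -/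
def mellinTransform (f : ℂ → ℂ) (ν : ℝ) (m : ℤ) : ℂ :=
  ∫ z : ℂ, f z * char ν m z * ((2 / ‖z‖ ^ 2 : ℝ) : ℂ)

/-- A smooth function on `(0, ∞)` that is `1` on `[1/2, 2]` and vanishes on
`(0, 1/3] ∪ [3, ∞)`. Its values outside `(0, ∞)` are irrelevant. -/
structure IsCutoff (v : ℝ → ℝ) : Prop where
  smooth : ContDiffOn ℝ ∞ v (Ioi 0)
  eq_one : ∀ x ∈ Icc (1 / 2 : ℝ) 2, v x = 1
  eq_zero : ∀ x ∈ Ioc (0 : ℝ) (1 / 3) ∪ Ici 3, v x = 0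

/-- The coefficient `ξ_R(ν, m)`, normalised so that `(ν, m) ↦ ξ_R(2ν, m)` is `1 / (4π²)` times the
Mellin transform of `v(|z|/R) e(2 Re z)`. -/
def xi (v : ℝ → ℝ) (R ν : ℝ) (m : ℤ) : ℂ :=
  ((1 / (4 * Real.pi ^ 2) : ℝ) : ℂ) *
    mellinTransform (fun z => (v (‖z‖ / R) : ℂ) * e (2 * z.re)) (ν / 2) m

/-- The measure on the unitary dual `ℝ × ℤ` of `ℂˣ`: Lebesgue measure times counting measure. -/
def dualMeasure : Measure (ℝ × ℤ) := (volume : Measure ℝ).prod Measure.count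

end ComplexMellin

end

/-!
The lemma is Mellin inversion on `ℂˣ` (Fourier series in the angle, the Mellin inversion theorem in
the radius), applied to `v(|z|/R) e(2 Re z)`, and an estimate of the transform. After rescaling by
`R`, `ξ_R(ν, m)` is, up to a unimodular factor, the integral of a fixed test function against
`osc(z) = e(2R Re z) χ_{iν/2,m}(z)`, which satisfies `z ∂_z osc = Ψ osc` with the affine function
`Ψ(z) = 2πiRz + (iν + m)/2`.

Where `|Ψ| ≳ R + |ν| + |m|`, repeated integration by parts with `osc = z ∂_z osc / Ψ` gives
arbitrary decay. Otherwise `|Ψ| ≲ R` on the support, and a single integration by parts with `1 / Ψ`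
regularised to `conj Ψ / (|Ψ|² + R)` bounds the integral by a multiple of
`R ∫ dx dy / (|Ψ|² + R)` over a bounded disc, which is `O(log R / R)` because `|Ψ|` is `2πR` times
the distance to the zero of `Ψ`.
-/

noncomputable section

namespace ComplexMellin

open Filter
open Complex (I)
open scoped Real Topology ComplexConjugate

lemma continuous_mul_of_continuousAt_tsupport {X M : Type*} [TopologicalSpace X]
    [TopologicalSpace M] [MulZeroClass M] [ContinuousMul M] {W F : X → M}
    (hW : Continuous W) (hF : ∀ x ∈ tsupport W, ContinuousAt F x) :
    Continuous fun x => W x * F x :=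
  continuous_of_tsupport fun x hx => hW.continuousAt.mul (hF x (tsupport_mul_subset_left hx))

lemma integrable_mul_of_continuousAt_tsupport {X E : Type*} [TopologicalSpace X]
    [MeasurableSpace X] [OpensMeasurableSpace X] {μ : Measure X} [IsFiniteMeasureOnCompacts μ]
    [NormedRing E] {W F : X → E} (hW : Continuous W) (hWc : HasCompactSupport W)
    (hF : ∀ x ∈ tsupport W, ContinuousAt F x) :
    Integrable (fun x => W x * F x) μ :=
  (continuous_mul_of_continuousAt_tsupport hW hF).integrable_of_hasCompactSupport hWc.mul_right

section Wirtinger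

/-- The Wirtinger derivative `∂f/∂z = (∂f/∂x - i ∂f/∂y) / 2`. -/
def wirtingerDeriv (f : ℂ → ℂ) (z : ℂ) : ℂ :=
  (fderiv ℝ f z 1 - I * fderiv ℝ f z I) / 2

/-- `f` is real differentiable at `z`, with Wirtinger derivative `f'` there. -/
structure HasWirtingerDerivAt (f : ℂ → ℂ) (f' z : ℂ) : Prop where
  differentiableAt : DifferentiableAt ℝ f z
  wirtingerDeriv_eq : wirtingerDeriv f z = f'

variable {f g h : ℂ → ℂ} {f' g' h' z : ℂ}

namespace HasWirtingerDerivAt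

lemma mul (hf : HasWirtingerDerivAt f f' z) (hg : HasWirtingerDerivAt g g' z) :
    HasWirtingerDerivAt (fun x => f x * g x) (f' * g z + f z * g') z := by
  refine ⟨hf.differentiableAt.mul hg.differentiableAt, ?_⟩
  rw [wirtingerDeriv, fderiv_fun_mul hf.differentiableAt hg.differentiableAt,
    ← hf.wirtingerDeriv_eq, ← hg.wirtingerDeriv_eq]
  simp only [wirtingerDeriv, _root_.add_apply, _root_.smul_apply, smul_eq_mul]
  ring

lemma congr_deriv (hf : HasWirtingerDerivAt f f' z) (h : f' = g') : HasWirtingerDerivAt f g' z :=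
  h ▸ hf

lemma congr_of_eventuallyEq (hf : HasWirtingerDerivAt f f' z) (h : g =ᶠ[𝓝 z] f) :
    HasWirtingerDerivAt g f' z := by
  refine ⟨hf.differentiableAt.congr_of_eventuallyEq h, ?_⟩
  rw [wirtingerDeriv, h.fderiv_eq, ← wirtingerDeriv, hf.wirtingerDeriv_eq]

end HasWirtingerDerivAt

lemma hasWirtingerDerivAt_conj_of_hasDerivAt (hh : HasDerivAt h h' z) :
    HasWirtingerDerivAt (fun x => conj (h x)) 0 z := by
  have hcomp : HasFDerivAt (fun x => conj (h x)) _ z :=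
    Complex.conjCLE.hasFDerivAt.comp z (hh.hasFDerivAt.restrictScalars ℝ)
  refine ⟨hcomp.differentiableAt, ?_⟩
  rw [wirtingerDeriv, hcomp.fderiv]
  simp [← mul_assoc]

lemma hasWirtingerDerivAt_comp (hh : HasDerivAt h h' (f z)) (hf : HasWirtingerDerivAt f f' z) :
    HasWirtingerDerivAt (fun x => h (f x)) (h' * f') z := by
  have hcomp : HasFDerivAt (fun x => h (f x)) _ z :=
    (hh.hasFDerivAt.restrictScalars ℝ).comp z hf.differentiableAt.hasFDerivAt
  refine ⟨hcomp.differentiableAt, ?_⟩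
  rw [wirtingerDeriv, hcomp.fderiv, ← hf.wirtingerDeriv_eq]
  simp only [wirtingerDeriv, ContinuousLinearMap.comp_apply,
    ContinuousLinearMap.coe_restrictScalars', ContinuousLinearMap.toSpanSingleton_apply,
    smul_eq_mul]
  ring

lemma hasWirtingerDerivAt_of_hasDerivAt (hh : HasDerivAt h h' z) :
    HasWirtingerDerivAt h h' z := by
  have hh' := hh.hasFDerivAt.restrictScalars ℝ
  refine ⟨hh'.differentiableAt, ?_⟩
  rw [wirtingerDeriv, hh'.fderiv]
  simp only [ContinuousLinearMap.coe_restrictScalars', ContinuousLinearMap.toSpanSingleton_apply,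
    smul_eq_mul]
  linear_combination -h' / 2 * Complex.I_mul_I

lemma tsupport_wirtingerDeriv_subset (f : ℂ → ℂ) : tsupport (wirtingerDeriv f) ⊆ tsupport f := by
  refine closure_minimal (fun z hz => ?_) (isClosed_tsupport f)
  by_contra h
  refine hz ?_
  have : fderiv ℝ f z = 0 := by
    by_contra h'
    exact h (support_fderiv_subset ℝ h')
  simp [wirtingerDeriv, this]

lemma contDiff_wirtingerDeriv {f : ℂ → ℂ} {n k : ℕ∞} (hf : ContDiff ℝ n f) (h : k + 1 ≤ n) :
    ContDiff ℝ k (wirtingerDeriv f) := by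
  have hf' : ContDiff ℝ k (fderiv ℝ f) := hf.fderiv_right (by exact_mod_cast h)
  unfold wirtingerDeriv
  fun_prop

lemma integral_mul_wirtingerDeriv {W F : ℂ → ℂ} (hW : ContDiff ℝ 1 W)
    (hWc : HasCompactSupport W) (hF : ∀ z ∈ tsupport W, ContDiffAt ℝ 1 F z) :
    ∫ z, W z * wirtingerDeriv F z = -∫ z, wirtingerDeriv W z * F z := by
  have hF' (w : ℂ) : ∀ z ∈ tsupport W, ContinuousAt (fun z => fderiv ℝ F z w) z := fun z hz =>
    ((hF z hz).continuousAt_fderiv one_ne_zero).clm_apply continuousAt_const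
  have hW' (w : ℂ) : Integrable fun z => fderiv ℝ W z w * F z :=
    integrable_mul_of_continuousAt_tsupport
      ((hW.continuous_fderiv one_ne_zero).clm_apply continuous_const)
      (hWc.fderiv_apply ℝ w) fun z hz => (hF z (tsupport_fderiv_apply_subset ℝ w hz)).continuousAt
  have hWF' (w : ℂ) : Integrable fun z => W z * fderiv ℝ F z w :=
    integrable_mul_of_continuousAt_tsupport hW.continuous hWc (hF' w)
  have parts (w : ℂ) : ∫ z, W z * fderiv ℝ F z w = -∫ z, fderiv ℝ W z w * F z :=
    integral_mul_fderiv_eq_neg_fderiv_mul_of_integrable (hW' w) (hWF' w)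
      (integrable_mul_of_continuousAt_tsupport hW.continuous hWc fun z hz =>
        (hF z hz).continuousAt)
      (fun z _ => hW.differentiable one_ne_zero z)
      (fun z hz => (hF z hz).differentiableAt one_ne_zero)
  calc ∫ z, W z * wirtingerDeriv F z
      = ∫ z, (W z * fderiv ℝ F z 1 - I * (W z * fderiv ℝ F z I)) / 2 := by
        congr with z
        rw [wirtingerDeriv]
        ring
    _ = ((∫ z, W z * fderiv ℝ F z 1) - I * ∫ z, W z * fderiv ℝ F z I) / 2 := by
        rw [integral_div, integral_sub (hWF' 1) ((hWF' I).const_mul I), integral_const_mul]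
    _ = -(((∫ z, fderiv ℝ W z 1 * F z) - I * ∫ z, fderiv ℝ W z I * F z) / 2) := by
        rw [parts, parts]
        ring
    _ = -∫ z, (fderiv ℝ W z 1 * F z - I * (fderiv ℝ W z I * F z)) / 2 := by
        rw [integral_div, integral_sub (hW' 1) ((hW' I).const_mul I), integral_const_mul]
    _ = -∫ z, wirtingerDeriv W z * F z := by
        congr with z
        rw [wirtingerDeriv]
        ring

end Wirtinger

section TestFunctions

/-- The class `C_c^∞(ℂˣ)`, as functions on the whole plane which vanish near `0`. -/
structure IsTestFunction (W : ℂ → ℂ) : Prop where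
  contDiff : ContDiff ℝ ∞ W
  hasCompactSupport : HasCompactSupport W
  zero_notMem_tsupport : 0 ∉ tsupport W

namespace IsTestFunction

variable {W F g : ℂ → ℂ}

lemma ne_zero_of_mem_tsupport (hW : IsTestFunction W) {z : ℂ} (hz : z ∈ tsupport W) : z ≠ 0 :=
  fun h => hW.zero_notMem_tsupport (h ▸ hz)

lemma mul_contDiffAt (hW : IsTestFunction W) (hg : ∀ z ≠ 0, ContDiffAt ℝ ∞ g z) :
    IsTestFunction fun z => W z * g z where
  contDiff := contMDiff_iff_contDiff.1 <| contMDiff_of_tsupport fun z hz =>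
    (hW.contDiff.contDiffAt.mul
      (hg z (hW.ne_zero_of_mem_tsupport (tsupport_mul_subset_left hz)))).contMDiffAt
  hasCompactSupport := hW.hasCompactSupport.mul_right
  zero_notMem_tsupport h := hW.zero_notMem_tsupport (tsupport_mul_subset_left h)

lemma wirtingerDeriv (hW : IsTestFunction W) : IsTestFunction (wirtingerDeriv W) where
  contDiff := contDiff_wirtingerDeriv hW.contDiff le_rfl
  hasCompactSupport := hW.hasCompactSupport.of_isClosed_subset (isClosed_tsupport _)
    (tsupport_wirtingerDeriv_subset W)
  zero_notMem_tsupport h := hW.zero_notMem_tsupport (tsupport_wirtingerDeriv_subset W h)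

lemma exists_norm_mem_Icc (hW : IsTestFunction W) :
    ∃ a b : ℝ, 0 < a ∧ ∀ z, W z ≠ 0 → ‖z‖ ∈ Icc a b := by
  obtain ⟨b, hb⟩ := hW.hasCompactSupport.isBounded.exists_norm_le
  obtain ⟨a, ha, hball⟩ := Metric.isOpen_iff.1 (isClosed_tsupport W).isOpen_compl 0
    hW.zero_notMem_tsupport
  refine ⟨a, b, ha, fun z hz => ⟨?_, hb z (subset_tsupport W hz)⟩⟩
  by_contra! h
  exact hball (by simpa using h) (subset_tsupport W hz)

lemma integrable_mul (hW : IsTestFunction W) (hF : ∀ z ∈ tsupport W, ContinuousAt F z) :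
    Integrable fun z => W z * F z :=
  integrable_mul_of_continuousAt_tsupport hW.contDiff.continuous hW.hasCompactSupport hF

lemma integral_mul_eq_neg {F' : ℂ → ℂ} (hW : IsTestFunction W)
    (hF : ∀ z ∈ tsupport W, ContDiffAt ℝ 1 F z)
    (hF' : ∀ z ∈ tsupport W, HasWirtingerDerivAt F (F' z) z) :
    ∫ z, W z * F' z = -∫ z, ComplexMellin.wirtingerDeriv W z * F z := by
  rw [← integral_mul_wirtingerDeriv (hW.contDiff.of_le (by simp)) hW.hasCompactSupport hF]
  congr with z
  by_cases hz : z ∈ tsupport W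
  · rw [(hF' z hz).wirtingerDeriv_eq]
  · rw [image_eq_zero_of_notMem_tsupport hz, zero_mul, zero_mul]

end IsTestFunction

end TestFunctions

section Oscillation

/-- The oscillating factor `e(2t Re z) χ_{iν,m}(z)`. -/
def osc (t ν : ℝ) (m : ℤ) (z : ℂ) : ℂ := e (2 * (t * z.re)) * char ν m z

/-- The logarithmic derivative `(z ∂/∂z) log` of `osc t ν m`. -/
def phaseSlope (t ν : ℝ) (m : ℤ) (z : ℂ) : ℂ := 2 * π * I * t * z + (I * ν + m / 2)

lemma norm_two_pi_I_mul {t : ℝ} (ht : 0 ≤ t) : ‖2 * π * I * t‖ = 2 * π * t := by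
  simp [abs_of_pos Real.pi_pos, abs_of_nonneg ht]

variable (t ν : ℝ) (m : ℤ) {z : ℂ}

lemma norm_e (x : ℝ) : ‖e x‖ = 1 := by
  rw [e, show 2 * π * I * x = ((2 * π * x : ℝ) : ℂ) * I by push_cast; ring,
    Complex.norm_exp_ofReal_mul_I]

lemma norm_char (hz : z ≠ 0) : ‖char ν m z‖ = 1 := by
  have hnorm : 0 < ‖z‖ := norm_pos_iff.2 hz
  rw [char, norm_mul, Complex.norm_cpow_eq_rpow_re_of_pos hnorm, norm_zpow, norm_div]
  simp [hnorm.ne']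

lemma norm_osc (hz : z ≠ 0) : ‖osc t ν m z‖ = 1 := by
  rw [osc, norm_mul, norm_e, norm_char ν m hz, one_mul]

lemma e_two_mul_re (z : ℂ) :
    e (2 * (t * z.re)) =
      Complex.exp (2 * π * I * t * z) * Complex.exp (2 * π * I * t * conj z) := by
  rw [e, ← Complex.exp_add, ← mul_add, Complex.add_conj]
  push_cast
  ring_nf

lemma char_eq_exp_mul_zpow (hz : z ≠ 0) :
    char ν m z = Complex.exp ((I * ν - m / 2) * Complex.log (z * conj z)) * z ^ m := by
  have hnorm : (‖z‖ : ℂ) ≠ 0 := by simpa using hz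
  have hlog : Complex.log (z * conj z) = 2 * Complex.log ‖z‖ := by
    rw [Complex.mul_conj', ← Complex.ofReal_pow, ← Complex.ofReal_log (by positivity),
      ← Complex.ofReal_log (norm_nonneg z), Real.log_pow]
    push_cast
    rfl
  rw [char, Complex.cpow_def_of_ne_zero hnorm, hlog, div_zpow, ← Complex.cpow_intCast (‖z‖ : ℂ),
    Complex.cpow_def_of_ne_zero hnorm, div_eq_mul_inv, ← Complex.exp_neg, mul_left_comm,
    ← Complex.exp_add, mul_comm]
  ring_nf

lemma mul_conj_mem_slitPlane (hz : z ≠ 0) : z * conj z ∈ Complex.slitPlane := by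
  rw [Complex.mul_conj, Complex.ofReal_mem_slitPlane]
  exact Complex.normSq_pos.2 hz

lemma osc_eventuallyEq (hz : z ≠ 0) : osc t ν m =ᶠ[𝓝 z] fun w =>
    Complex.exp (2 * π * I * t * w) * Complex.exp (2 * π * I * t * conj w) *
      (Complex.exp ((I * ν - m / 2) * Complex.log (w * conj w)) * w ^ m) := by
  filter_upwards [isOpen_ne.mem_nhds hz] with w hw
  rw [osc, e_two_mul_re, char_eq_exp_mul_zpow ν m hw]

lemma contDiffAt_osc (hz : z ≠ 0) : ContDiffAt ℝ ∞ (osc t ν m) z := by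
  have hconj : ContDiff ℝ ∞ fun w : ℂ => conj w := Complex.conjCLE.contDiff
  have hlog : ContDiffAt ℝ ∞ (fun w : ℂ => Complex.log (w * conj w)) z :=
    ContDiffAt.comp (g := Complex.log) z
      ((Complex.contDiffAt_log (mul_conj_mem_slitPlane hz)).restrict_scalars ℝ)
      (contDiffAt_id.mul hconj.contDiffAt)
  have hzpow : ContDiffAt ℝ ∞ (fun w : ℂ => w ^ m) z :=
    (analyticAt_id (𝕜 := ℂ).zpow hz).contDiffAt.restrict_scalars ℝ
  refine ContDiffAt.congr_of_eventuallyEq ?_ (osc_eventuallyEq t ν m hz)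
  fun_prop

lemma hasWirtingerDerivAt_osc (hz : z ≠ 0) :
    HasWirtingerDerivAt (osc t ν m) (z⁻¹ * phaseSlope t ν m z * osc t ν m z) z := by
  have hlin (w : ℂ) : HasDerivAt (fun x => Complex.exp (2 * π * I * t * x))
      (Complex.exp (2 * π * I * t * w) * (2 * π * I * t)) w := by
    simpa using ((hasDerivAt_id w).const_mul (2 * π * I * t)).cexp
  have hexplog : HasDerivAt (fun x => Complex.exp ((I * ν - m / 2) * Complex.log x))
      (Complex.exp ((I * ν - m / 2) * Complex.log (z * conj z)) *
        ((I * ν - m / 2) * (z * conj z)⁻¹)) (z * conj z) :=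
    ((Complex.hasDerivAt_log (mul_conj_mem_slitPlane hz)).const_mul _).cexp
  have hconj : HasWirtingerDerivAt (fun x => conj x) 0 z :=
    hasWirtingerDerivAt_conj_of_hasDerivAt (hasDerivAt_id z)
  have hid : HasWirtingerDerivAt (fun x : ℂ => x) 1 z :=
    hasWirtingerDerivAt_of_hasDerivAt (hasDerivAt_id z)
  have hzpow : HasWirtingerDerivAt (fun x : ℂ => x ^ m) (m * z ^ (m - 1)) z :=
    hasWirtingerDerivAt_of_hasDerivAt (hasDerivAt_zpow m z (Or.inl hz))
  have hprod := ((hasWirtingerDerivAt_of_hasDerivAt (hlin z)).mul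
    (hasWirtingerDerivAt_comp (hlin (conj z)) hconj)).mul
    ((hasWirtingerDerivAt_comp (f := fun x => x * conj x) hexplog (hid.mul hconj)).mul hzpow)
  have hosc := osc_eventuallyEq t ν m hz
  refine (hprod.congr_of_eventuallyEq hosc).congr_deriv ?_
  have hconj₀ : conj z ≠ 0 := by simpa using hz
  rw [hosc.eq_of_nhds, phaseSlope, zpow_sub_one₀ hz]
  field_simp
  ring

end Oscillation

section NonstationaryPhase

lemma hasDerivAt_phaseSlope (t ν : ℝ) (m : ℤ) (z : ℂ) :
    HasDerivAt (phaseSlope t ν m) (2 * π * I * t) z :=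
  (((hasDerivAt_id z).const_mul _).add_const _).congr_deriv (mul_one _)

lemma contDiff_phaseSlope (t ν : ℝ) (m : ℤ) : ContDiff ℝ ∞ (phaseSlope t ν m) := by
  unfold phaseSlope
  fun_prop

lemma contDiffAt_inv_phaseSlope_pow_mul_osc (t ν : ℝ) (m : ℤ) (l : ℕ) {z : ℂ} (hz : z ≠ 0)
    (hΨ : phaseSlope t ν m z ≠ 0) :
    ContDiffAt ℝ ∞ (fun x => (phaseSlope t ν m x)⁻¹ ^ l * osc t ν m x) z :=
  (((contDiff_phaseSlope t ν m).contDiffAt.inv hΨ).pow l).mul (contDiffAt_osc t ν m hz)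

lemma hasWirtingerDerivAt_inv_phaseSlope_pow_mul_osc (t ν : ℝ) (m : ℤ) (l : ℕ) {z : ℂ}
    (hz : z ≠ 0) (hΨ : phaseSlope t ν m z ≠ 0) :
    HasWirtingerDerivAt (fun x => (phaseSlope t ν m x)⁻¹ ^ (l + 1) * osc t ν m x)
      (z⁻¹ * ((phaseSlope t ν m z)⁻¹ ^ l * osc t ν m z) -
        2 * π * I * t * (l + 1) * ((phaseSlope t ν m z)⁻¹ ^ (l + 2) * osc t ν m z)) z := by
  have hpow : HasDerivAt (fun x => (phaseSlope t ν m x)⁻¹ ^ (l + 1))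
      ((l + 1) * (phaseSlope t ν m z)⁻¹ ^ l * (-(2 * π * I * t) / phaseSlope t ν m z ^ 2)) z := by
    simpa using ((hasDerivAt_phaseSlope t ν m z).fun_inv hΨ).fun_pow (l + 1)
  refine ((hasWirtingerDerivAt_of_hasDerivAt hpow).mul
    (hasWirtingerDerivAt_osc t ν m hz)).congr_deriv ?_
  simp only [inv_pow, pow_succ]
  field_simp
  ring

lemma IsTestFunction.integral_mul_inv_phaseSlope_pow_mul_osc {W : ℂ → ℂ} (hW : IsTestFunction W)
    (t ν : ℝ) (m : ℤ) (l : ℕ) (hΨ : ∀ z ∈ tsupport W, phaseSlope t ν m z ≠ 0) :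
    ∫ z, W z * ((phaseSlope t ν m z)⁻¹ ^ l * osc t ν m z) =
      2 * π * I * t * (l + 1) *
        (∫ z, W z * z * ((phaseSlope t ν m z)⁻¹ ^ (l + 2) * osc t ν m z)) -
      ∫ z, ComplexMellin.wirtingerDeriv (fun x => W x * x) z *
        ((phaseSlope t ν m z)⁻¹ ^ (l + 1) * osc t ν m z) := by
  have hV : IsTestFunction fun x => W x * x := hW.mul_contDiffAt fun _ _ => contDiffAt_id
  have hVW {z : ℂ} (hz : z ∈ tsupport fun x => W x * x) : z ∈ tsupport W :=
    tsupport_mul_subset_left hz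
  have hcont (l : ℕ) (z : ℂ) (hz : z ∈ tsupport W) :=
    contDiffAt_inv_phaseSlope_pow_mul_osc t ν m l (hW.ne_zero_of_mem_tsupport hz) (hΨ z hz)
  have parts := hV.integral_mul_eq_neg
    (fun z hz => (hcont (l + 1) z (hVW hz)).of_le (by simp))
    (fun z hz => hasWirtingerDerivAt_inv_phaseSlope_pow_mul_osc t ν m l
      (hV.ne_zero_of_mem_tsupport hz) (hΨ z (hVW hz)))
  rw [sub_eq_add_neg, ← parts, ← integral_const_mul, ← integral_add]
  · congr with z
    rcases eq_or_ne z 0 with rfl | hz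
    · simp [image_eq_zero_of_notMem_tsupport hW.zero_notMem_tsupport]
    · field_simp
      ring
  · exact (hV.integrable_mul fun z hz => (hcont (l + 2) z (hVW hz)).continuousAt).const_mul _
  · refine hV.integrable_mul fun z hz => ?_
    have hl (l : ℕ) := (hcont l z (hVW hz)).continuousAt
    have hz0 := hV.ne_zero_of_mem_tsupport hz
    exact ((continuousAt_inv₀ hz0).mul (hl l)).sub (continuousAt_const.mul (hl (l + 2)))

lemma IsTestFunction.norm_integral_inv_phaseSlope_pow_mul_osc_le {W : ℂ → ℂ}
    (hW : IsTestFunction W) {c : ℝ} (hc : 0 < c) (l : ℕ) {S : ℝ} (hS : 0 < S) (t ν : ℝ) (m : ℤ)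
    (hΨ : ∀ z ∈ tsupport W, c * S ≤ ‖phaseSlope t ν m z‖) :
    ‖∫ z, W z * ((phaseSlope t ν m z)⁻¹ ^ l * osc t ν m z)‖ ≤
      (∫ z, ‖W z‖) * c⁻¹ ^ l * S⁻¹ ^ l := by
  rw [mul_assoc, ← mul_pow, ← mul_inv, ← integral_mul_const]
  refine norm_integral_le_of_norm_le
    ((hW.contDiff.continuous.integrable_of_hasCompactSupport hW.hasCompactSupport).norm.mul_const _)
    (Eventually.of_forall fun z => ?_)
  by_cases hz : z ∈ tsupport W
  · rw [norm_mul, norm_mul, norm_osc t ν m (hW.ne_zero_of_mem_tsupport hz), mul_one, norm_pow,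
      norm_inv]
    have := hΨ z hz
    gcongr
  · simp [image_eq_zero_of_notMem_tsupport hz]

/-- Each integration by parts gains a factor `S⁻¹`. -/
theorem IsTestFunction.exists_norm_integral_inv_phaseSlope_pow_mul_osc_le {c : ℝ} (hc : 0 < c)
    (N : ℕ) : ∀ {W : ℂ → ℂ}, IsTestFunction W → ∀ l : ℕ, ∃ C, ∀ t S ν : ℝ, ∀ m : ℤ,
      0 ≤ t → t ≤ S → 0 < S → (∀ z ∈ tsupport W, c * S ≤ ‖phaseSlope t ν m z‖) →
        ‖∫ z, W z * ((phaseSlope t ν m z)⁻¹ ^ l * osc t ν m z)‖ ≤ C * S⁻¹ ^ (l + N) := by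
  induction N with
  | zero =>
    exact fun hW l => ⟨_, fun t S ν m _ _ hS hΨ =>
      hW.norm_integral_inv_phaseSlope_pow_mul_osc_le hc l hS t ν m hΨ⟩
  | succ N ih =>
    intro W hW l
    have hV : IsTestFunction fun x => W x * x := hW.mul_contDiffAt fun _ _ => contDiffAt_id
    have hVW {z : ℂ} (hz : z ∈ tsupport fun x => W x * x) : z ∈ tsupport W :=
      tsupport_mul_subset_left hz
    obtain ⟨C₁, hC₁⟩ := ih hV (l + 2)
    obtain ⟨C₂, hC₂⟩ := ih hV.wirtingerDeriv (l + 1)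
    refine ⟨2 * π * (l + 1) * C₁ + C₂, fun t S ν m ht htS hS hΨ => ?_⟩
    have hΨ₀ (z : ℂ) (hz : z ∈ tsupport W) : phaseSlope t ν m z ≠ 0 :=
      norm_pos_iff.1 ((mul_pos hc hS).trans_le (hΨ z hz))
    have bound₁ := hC₁ t S ν m ht htS hS fun z hz => hΨ z (hVW hz)
    have bound₂ := hC₂ t S ν m ht htS hS fun z hz =>
      hΨ z (hVW (tsupport_wirtingerDeriv_subset _ hz))
    have hcoeff : ‖2 * π * I * t * (l + 1)‖ = 2 * π * t * (l + 1) := by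
      rw [norm_mul, norm_two_pi_I_mul ht, ← Nat.cast_succ, Complex.norm_natCast, Nat.cast_succ]
    rw [hW.integral_mul_inv_phaseSlope_pow_mul_osc t ν m l hΨ₀]
    refine (norm_sub_le _ _).trans ?_
    rw [norm_mul, hcoeff]
    calc _ ≤ 2 * π * S * (l + 1) * (C₁ * S⁻¹ ^ (l + 2 + N)) + C₂ * S⁻¹ ^ (l + 1 + N) := by
          gcongr
      _ = (2 * π * (l + 1) * C₁ + C₂) * S⁻¹ ^ (l + (N + 1)) := by
          rw [show l + 2 + N = l + (N + 1) + 1 by ring, show l + 1 + N = l + (N + 1) by ring,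
            pow_succ]
          field_simp

theorem IsTestFunction.exists_norm_integral_mul_osc_le_pow {W : ℂ → ℂ} (hW : IsTestFunction W)
    {c : ℝ} (hc : 0 < c) (N : ℕ) : ∃ C, ∀ t S ν : ℝ, ∀ m : ℤ, 0 ≤ t → t ≤ S → 0 < S →
      (∀ z ∈ tsupport W, c * S ≤ ‖phaseSlope t ν m z‖) →
        ‖∫ z, W z * osc t ν m z‖ ≤ C * S⁻¹ ^ N := by
  simpa using exists_norm_integral_inv_phaseSlope_pow_mul_osc_le hc N hW 0

end NonstationaryPhase

section StationaryRange

lemma integral_mul_inv_sq_add {a ρ : ℝ} (ha : 0 < a) :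
    ∫ y in 0..ρ, y * (y ^ 2 + a)⁻¹ = Real.log (ρ ^ 2 / a + 1) / 2 := by
  have hpos (y : ℝ) : y ^ 2 + a ≠ 0 := by positivity
  have hcont : Continuous fun y : ℝ => y * (y ^ 2 + a)⁻¹ :=
    continuous_id.mul ((by fun_prop : Continuous fun y : ℝ => y ^ 2 + a).inv₀ hpos)
  have hderiv (y : ℝ) : HasDerivAt (fun y => Real.log (y ^ 2 + a) / 2) (y * (y ^ 2 + a)⁻¹) y := by
    refine ((((hasDerivAt_pow 2 y).add_const a).log (hpos y)).div_const 2).congr_deriv ?_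
    simp only [Nat.cast_ofNat, Nat.add_one_sub_one, pow_one]
    field_simp
  rw [intervalIntegral.integral_eq_sub_of_hasDerivAt (fun y _ => hderiv y)
    (hcont.intervalIntegrable _ _), zero_pow two_ne_zero, zero_add, ← sub_div,
    ← Real.log_div (hpos ρ) ha.ne', add_div, div_self ha.ne']

lemma integral_closedBall_inv_sq_add {a ρ : ℝ} (ha : 0 < a) (hρ : 0 ≤ ρ) (z₀ : ℂ) :
    ∫ z in Metric.closedBall z₀ ρ, (‖z - z₀‖ ^ 2 + a)⁻¹ = π * Real.log (ρ ^ 2 / a + 1) := by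
  have hball : (Metric.closedBall z₀ ρ).indicator (fun z => (‖z - z₀‖ ^ 2 + a)⁻¹) =
      fun z => (Iic ρ).indicator (fun y => (y ^ 2 + a)⁻¹) ‖z - z₀‖ := by
    ext z
    by_cases hz : ‖z - z₀‖ ≤ ρ <;> simp [indicator, dist_eq_norm, hz]
  have hradial : ∫ y in Ioi (0 : ℝ), y ^ 1 • (Iic ρ).indicator (fun y => (y ^ 2 + a)⁻¹) y =
      Real.log (ρ ^ 2 / a + 1) / 2 := by
    rw [← integral_mul_inv_sq_add ha, intervalIntegral.integral_of_le hρ, ← Ioi_inter_Iic,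
      ← setIntegral_indicator measurableSet_Iic]
    congr with y
    by_cases hy : y ≤ ρ <;> simp [hy]
  rw [← integral_indicator Metric.isClosed_closedBall.measurableSet, hball,
    integral_sub_right_eq_self (fun z => (Iic ρ).indicator (fun y => (y ^ 2 + a)⁻¹) ‖z‖),
    integral_fun_norm_addHaar volume, Complex.finrank_real_complex, hradial, measureReal_def,
    Complex.volume_ball]
  simp only [ENNReal.ofReal_one, one_pow, one_mul, ENNReal.coe_toReal, NNReal.coe_real_pi,
    smul_eq_mul, nsmul_eq_mul, Nat.cast_ofNat]
  ring

variable {t : ℝ} (ν : ℝ) (m : ℤ)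

/-- The square of the modulus of `phaseSlope`, regularised to be nonzero at the stationary point.
The scale `t` of the regularisation is the one on which `osc t ν m` oscillates near that point. -/
def regSq (t ν : ℝ) (m : ℤ) (z : ℂ) : ℂ := phaseSlope t ν m z * conj (phaseSlope t ν m z) + t

lemma regSq_eq_ofReal (z : ℂ) : regSq t ν m z = ((‖phaseSlope t ν m z‖ ^ 2 + t : ℝ) : ℂ) := by
  rw [regSq, Complex.mul_conj']
  push_cast
  rfl

lemma regSq_ne_zero (ht : 0 < t) (z : ℂ) : regSq t ν m z ≠ 0 := by
  rw [regSq_eq_ofReal, Complex.ofReal_ne_zero]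
  positivity

lemma contDiff_conj_phaseSlope : ContDiff ℝ ∞ fun z => conj (phaseSlope t ν m z) :=
  Complex.conjCLE.contDiff.comp (contDiff_phaseSlope t ν m)

lemma contDiff_inv_regSq (ht : 0 < t) : ContDiff ℝ ∞ fun z => (regSq t ν m z)⁻¹ :=
  (((contDiff_phaseSlope t ν m).mul (contDiff_conj_phaseSlope ν m)).add contDiff_const).inv
    (regSq_ne_zero ν m ht)

lemma hasWirtingerDerivAt_conj_phaseSlope_mul_osc (ht : 0 < t) {z : ℂ} (hz : z ≠ 0) :
    HasWirtingerDerivAt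
      (fun x => conj (phaseSlope t ν m x) * ((regSq t ν m x)⁻¹ * osc t ν m x))
      (z⁻¹ * osc t ν m z - (z⁻¹ * t + 2 * π * I * t * conj (phaseSlope t ν m z) ^ 2 *
        (regSq t ν m z)⁻¹) * ((regSq t ν m z)⁻¹ * osc t ν m z)) z := by
  have hslope := hasDerivAt_phaseSlope t ν m z
  have hconj := hasWirtingerDerivAt_conj_of_hasDerivAt hslope
  have hreg : HasWirtingerDerivAt (regSq t ν m)
      (2 * π * I * t * conj (phaseSlope t ν m z)) z :=
    (hasWirtingerDerivAt_comp ((hasDerivAt_id _).add_const (t : ℂ))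
      ((hasWirtingerDerivAt_of_hasDerivAt hslope).mul hconj)).congr_deriv (by simp)
  have hne := regSq_ne_zero ν m ht z
  refine (hconj.mul ((hasWirtingerDerivAt_comp (hasDerivAt_inv hne) hreg).mul
    (hasWirtingerDerivAt_osc t ν m hz))).congr_deriv ?_
  have hsq : phaseSlope t ν m z * conj (phaseSlope t ν m z) = regSq t ν m z - t := by
    rw [regSq, add_sub_cancel_right]
  field_simp
  linear_combination (regSq t ν m z * osc t ν m z) * hsq

/-- One integration by parts against `conj (phaseSlope t ν m) / regSq t ν m` turns the amplitude `W`
of `osc t ν m` into `regAmplitude W t ν m / regSq t ν m`. -/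
def regAmplitude (W : ℂ → ℂ) (t ν : ℝ) (m : ℤ) (z : ℂ) : ℂ :=
  t * W z + 2 * π * I * t * (W z * z) * (conj (phaseSlope t ν m z) ^ 2 * (regSq t ν m z)⁻¹) -
    wirtingerDeriv (fun x => W x * x) z * conj (phaseSlope t ν m z)

lemma IsTestFunction.integral_mul_osc_eq_regAmplitude {W : ℂ → ℂ} (hW : IsTestFunction W)
    (ht : 0 < t) :
    ∫ z, W z * osc t ν m z =
      ∫ z, regAmplitude W t ν m z * ((regSq t ν m z)⁻¹ * osc t ν m z) := by
  have hV : IsTestFunction fun x => W x * x := hW.mul_contDiffAt fun _ _ => contDiffAt_id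
  have hinv := contDiff_inv_regSq ν m ht
  have hconj := contDiff_conj_phaseSlope (t := t) ν m
  have hF (z : ℂ) (hz : z ≠ 0) : ContDiffAt ℝ ∞
      (fun x => conj (phaseSlope t ν m x) * ((regSq t ν m x)⁻¹ * osc t ν m x)) z :=
    hconj.contDiffAt.mul (hinv.contDiffAt.mul (contDiffAt_osc t ν m hz))
  have parts := hV.integral_mul_eq_neg
    (fun z hz => (hF z (hV.ne_zero_of_mem_tsupport hz)).of_le (by simp))
    (fun z hz => hasWirtingerDerivAt_conj_phaseSlope_mul_osc ν m ht
      (hV.ne_zero_of_mem_tsupport hz))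
  have hosc (z : ℂ) (hz : z ≠ 0) := (contDiffAt_osc t ν m hz).continuousAt
  have hderiv (z : ℂ) (hz : z ∈ tsupport fun x => W x * x) : ContinuousAt (fun z =>
      z⁻¹ * osc t ν m z - (z⁻¹ * t + 2 * π * I * t * conj (phaseSlope t ν m z) ^ 2 *
        (regSq t ν m z)⁻¹) * ((regSq t ν m z)⁻¹ * osc t ν m z)) z := by
    have hz₀ := continuousAt_inv₀ (hV.ne_zero_of_mem_tsupport hz)
    have hoscz := hosc z (hV.ne_zero_of_mem_tsupport hz)
    have hinvz := hinv.continuous.continuousAt (x := z)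
    have hconjz := hconj.continuous.continuousAt (x := z)
    exact (hz₀.mul hoscz).sub (((hz₀.mul continuousAt_const).add
      ((continuousAt_const.mul (hconjz.pow 2)).mul hinvz)).mul (hinvz.mul hoscz))
  rw [← sub_zero (∫ z, W z * osc t ν m z), ← add_eq_zero_iff_eq_neg.2 parts, ← integral_add
    (hV.integrable_mul hderiv) (hV.wirtingerDeriv.integrable_mul fun z hz =>
      (hF z (hV.wirtingerDeriv.ne_zero_of_mem_tsupport hz)).continuousAt), ← integral_sub
    (hW.integrable_mul fun z hz => hosc z (hW.ne_zero_of_mem_tsupport hz))]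
  · congr with z
    rcases eq_or_ne z 0 with rfl | hz
    · simp [regAmplitude, image_eq_zero_of_notMem_tsupport hW.zero_notMem_tsupport,
        image_eq_zero_of_notMem_tsupport hV.wirtingerDeriv.zero_notMem_tsupport]
    · rw [regAmplitude]
      field_simp
      ring
  · exact (hV.integrable_mul hderiv).add (hV.wirtingerDeriv.integrable_mul fun z hz =>
      (hF z (hV.wirtingerDeriv.ne_zero_of_mem_tsupport hz)).continuousAt)

lemma IsTestFunction.exists_norm_regAmplitude_le {W : ℂ → ℂ} (hW : IsTestFunction W) {c : ℝ} :
    ∃ C, 0 ≤ C ∧ ∀ t ν m, 0 < t → (∀ z ∈ tsupport W, ‖phaseSlope t ν m z‖ ≤ c * t) →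
      ∀ z, ‖regAmplitude W t ν m z‖ ≤ (tsupport W).indicator (fun _ => C * t) z := by
  have hV : IsTestFunction fun x => W x * x := hW.mul_contDiffAt fun _ _ => contDiffAt_id
  obtain ⟨M₀, hM₀⟩ := hW.contDiff.continuous.bounded_above_of_compact_support hW.hasCompactSupport
  obtain ⟨M₁, hM₁⟩ := hV.contDiff.continuous.bounded_above_of_compact_support hV.hasCompactSupport
  obtain ⟨M₂, hM₂⟩ := hV.wirtingerDeriv.contDiff.continuous.bounded_above_of_compact_support
    hV.wirtingerDeriv.hasCompactSupport
  have hM₀' := (norm_nonneg _).trans (hM₀ 0)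
  have hM₁' := (norm_nonneg _).trans (hM₁ 0)
  have hM₂' := (norm_nonneg _).trans (hM₂ 0)
  refine ⟨M₀ + 2 * π * M₁ + M₂ * |c|, by positivity, fun t ν m ht hΨ z => ?_⟩
  by_cases hz : z ∈ tsupport W
  · have hquot : ‖conj (phaseSlope t ν m z) ^ 2 * (regSq t ν m z)⁻¹‖ ≤ 1 := by
      rw [regSq_eq_ofReal, ← Complex.ofReal_inv, norm_mul, norm_pow, Complex.norm_conj,
        Complex.norm_of_nonneg (by positivity), ← div_eq_mul_inv]
      exact div_le_one_of_le₀ (by linarith) (by positivity)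
    rw [indicator_of_mem hz, regAmplitude]
    calc _ ≤ ‖(t : ℂ)‖ * ‖W z‖ + ‖2 * π * I * t‖ * ‖W z * z‖ *
            ‖conj (phaseSlope t ν m z) ^ 2 * (regSq t ν m z)⁻¹‖ +
            ‖ComplexMellin.wirtingerDeriv (fun x => W x * x) z‖ * ‖phaseSlope t ν m z‖ := by
          grw [norm_sub_le, norm_add_le]
          simp only [norm_mul, Complex.norm_conj, le_refl]
      _ ≤ t * M₀ + 2 * π * t * M₁ * 1 + M₂ * (|c| * t) := by
          rw [norm_two_pi_I_mul ht.le, Complex.norm_of_nonneg ht.le]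
          gcongr
          · exact hM₀ z
          · exact hM₁ z
          · exact hM₂ z
          · exact (hΨ z hz).trans (by gcongr; exact le_abs_self c)
      _ = _ := by ring
  · have hVz : z ∉ tsupport fun x => W x * x := fun h => hz (tsupport_mul_subset_left h)
    simp [regAmplitude, hz, image_eq_zero_of_notMem_tsupport hz,
      image_eq_zero_of_notMem_tsupport fun h => hVz (tsupport_wirtingerDeriv_subset _ h)]

/-- The zero of `phaseSlope t ν m`, i.e. the critical point of the phase of `osc t ν m`. -/
def stationaryPoint (t ν : ℝ) (m : ℤ) : ℂ := -(I * ν + m / 2) / (2 * π * I * t)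

lemma norm_phaseSlope_eq (ht : 0 < t) (z : ℂ) :
    ‖phaseSlope t ν m z‖ = 2 * π * t * ‖z - stationaryPoint t ν m‖ := by
  have hslope : phaseSlope t ν m z = 2 * π * I * t * (z - stationaryPoint t ν m) := by
    have hπ : (π : ℂ) ≠ 0 := Complex.ofReal_ne_zero.2 Real.pi_ne_zero
    have ht' : (t : ℂ) ≠ 0 := Complex.ofReal_ne_zero.2 ht.ne'
    rw [phaseSlope, stationaryPoint]
    field_simp
    ring
  rw [hslope, norm_mul, norm_two_pi_I_mul ht.le]

lemma mul_norm_sub_stationaryPoint_le (ht : 0 < t) (z : ℂ) :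
    t * ‖z - stationaryPoint t ν m‖ ≤ ‖phaseSlope t ν m z‖ := by
  rw [norm_phaseSlope_eq ν m ht, mul_assoc]
  exact le_mul_of_one_le_left (by positivity) (by linarith [Real.pi_gt_three])

lemma norm_inv_regSq_le (ht : 0 < t) (z : ℂ) :
    ‖(regSq t ν m z)⁻¹‖ ≤ (t ^ 2)⁻¹ * (‖z - stationaryPoint t ν m‖ ^ 2 + t⁻¹)⁻¹ := by
  have hslope := mul_norm_sub_stationaryPoint_le ν m ht z
  rw [regSq_eq_ofReal, norm_inv, Complex.norm_of_nonneg (by positivity), ← mul_inv]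
  gcongr
  calc t ^ 2 * (‖z - stationaryPoint t ν m‖ ^ 2 + t⁻¹)
      = (t * ‖z - stationaryPoint t ν m‖) ^ 2 + t := by field_simp
    _ ≤ ‖phaseSlope t ν m z‖ ^ 2 + t := by gcongr

theorem IsTestFunction.exists_norm_integral_mul_osc_le_log {W : ℂ → ℂ} (hW : IsTestFunction W)
    {c : ℝ} (hc : 0 ≤ c) : ∃ C, 0 ≤ C ∧ ∀ t ν m, 0 < t →
      (∀ z ∈ tsupport W, ‖phaseSlope t ν m z‖ ≤ c * t) →
        ‖∫ z, W z * osc t ν m z‖ ≤ C * (Real.log (c ^ 2 * t + 1) / t) := by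
  obtain ⟨C, hC, hA⟩ := hW.exists_norm_regAmplitude_le (c := c)
  refine ⟨C * π, by positivity, fun t ν m ht hΨ => ?_⟩
  set z₀ := stationaryPoint t ν m
  have hball (z : ℂ) (hz : z ∈ tsupport W) : z ∈ Metric.closedBall z₀ c := by
    rw [mem_closedBall_iff_norm]
    refine le_of_mul_le_mul_left ?_ ht
    rw [mul_comm t c]
    exact (mul_norm_sub_stationaryPoint_le ν m ht z).trans (hΨ z hz)
  have hcont : Continuous fun z => (‖z - z₀‖ ^ 2 + t⁻¹)⁻¹ :=
    (by fun_prop : Continuous fun z => ‖z - z₀‖ ^ 2 + t⁻¹).inv₀ fun z => by positivity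
  rw [hW.integral_mul_osc_eq_regAmplitude ν m ht]
  calc _ ≤ ∫ z in Metric.closedBall z₀ c, C * t⁻¹ * (‖z - z₀‖ ^ 2 + t⁻¹)⁻¹ := by
        rw [← integral_indicator Metric.isClosed_closedBall.measurableSet]
        refine norm_integral_le_of_norm_le ?_ (Eventually.of_forall fun z => ?_)
        · rw [integrable_indicator_iff Metric.isClosed_closedBall.measurableSet]
          exact ((continuous_const.mul hcont).continuousOn.integrableOn_compact
            (isCompact_closedBall z₀ c))
        have hAz := hA t ν m ht hΨ z
        by_cases hz : z ∈ tsupport W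
        · rw [indicator_of_mem hz] at hAz
          rw [indicator_of_mem (hball z hz), norm_mul, norm_mul,
            norm_osc t ν m (hW.ne_zero_of_mem_tsupport hz), mul_one]
          calc _ ≤ C * t * ((t ^ 2)⁻¹ * (‖z - z₀‖ ^ 2 + t⁻¹)⁻¹) := by
                gcongr
                exact norm_inv_regSq_le ν m ht z
            _ = _ := by field_simp
        · rw [indicator_of_notMem hz, norm_le_zero_iff] at hAz
          rw [hAz, zero_mul, norm_zero]
          exact indicator_nonneg (fun z _ => by positivity) z
    _ = C * π * (Real.log (c ^ 2 * t + 1) / t) := by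
        rw [integral_const_mul, integral_closedBall_inv_sq_add (inv_pos.2 ht) hc, div_inv_eq_mul]
        ring

end StationaryRange

section MellinDecay

lemma osc_zero (ν : ℝ) (m : ℤ) (z : ℂ) : osc 0 ν m z = char ν m z := by
  simp [osc, e]

lemma norm_dual_half (ν : ℝ) (m : ℤ) : ‖I * ν + m / 2‖ = √((2 * ν) ^ 2 + (m : ℝ) ^ 2) / 2 := by
  rw [show I * ν + m / 2 = ((m : ℝ) + ((2 * ν : ℝ) : ℂ) * I) / 2 by push_cast; ring, norm_div,
    Complex.norm_add_mul_I, Complex.norm_ofNat, add_comm]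

lemma abs_add_abs_le_two_mul_sqrt (x y : ℝ) : |x| + |y| ≤ 2 * √(x ^ 2 + y ^ 2) := by
  have hx : |x| ≤ √(x ^ 2 + y ^ 2) := Real.abs_le_sqrt (le_add_of_nonneg_right (sq_nonneg y))
  have hy : |y| ≤ √(x ^ 2 + y ^ 2) := Real.abs_le_sqrt (le_add_of_nonneg_left (sq_nonneg x))
  linarith

lemma continuous_char (m : ℤ) {z : ℂ} (hz : z ≠ 0) : Continuous fun ν => char ν m z :=
  ((by fun_prop : Continuous fun ν : ℝ => 2 * I * (ν : ℂ)).const_cpow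
    (Or.inl (by simpa using hz))).mul continuous_const

lemma mellinTransform_eq_integral_osc (f : ℂ → ℂ) (ν : ℝ) (m : ℤ) :
    mellinTransform f ν m = ∫ z, f z * ((2 / ‖z‖ ^ 2 : ℝ) : ℂ) * osc 0 ν m z := by
  simp only [mellinTransform, osc_zero, mul_right_comm]

namespace IsTestFunction

variable {f : ℂ → ℂ}

lemma mul_haarDensity (hf : IsTestFunction f) :
    IsTestFunction fun z => f z * ((2 / ‖z‖ ^ 2 : ℝ) : ℂ) :=
  hf.mul_contDiffAt fun _ hz => Complex.ofRealCLM.contDiff.contDiffAt.comp _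
    (contDiffAt_const.div ((contDiffAt_norm ℝ hz).pow 2) (pow_ne_zero 2 (norm_ne_zero_iff.2 hz)))

lemma norm_integral_mul_osc_le (hf : IsTestFunction f) (t ν : ℝ) (m : ℤ) :
    ‖∫ z, f z * osc t ν m z‖ ≤ ∫ z, ‖f z‖ := by
  refine norm_integral_le_of_norm_le
    (hf.contDiff.continuous.integrable_of_hasCompactSupport hf.hasCompactSupport).norm
    (Eventually.of_forall fun z => ?_)
  by_cases hz : z ∈ tsupport f
  · rw [norm_mul, norm_osc t ν m (hf.ne_zero_of_mem_tsupport hz), mul_one]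
  · simp [image_eq_zero_of_notMem_tsupport hz]

lemma exists_norm_mellinTransform_mul_pow_le (hf : IsTestFunction f) (N : ℕ) :
    ∃ C, ∀ (ν : ℝ) (m : ℤ), ‖mellinTransform f ν m‖ * (|2 * ν| + |(m : ℝ)|) ^ N ≤ C := by
  obtain ⟨C, hC⟩ := hf.mul_haarDensity.exists_norm_integral_mul_osc_le_pow
    (c := 1 / 4) (by norm_num) N
  refine ⟨max C (∫ z, ‖f z * ((2 / ‖z‖ ^ 2 : ℝ) : ℂ)‖), fun ν m => ?_⟩
  rw [mellinTransform_eq_integral_osc]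
  rcases (by positivity : 0 ≤ |2 * ν| + |(m : ℝ)|).eq_or_lt with hS | hS
  · refine le_trans ?_ (le_max_right _ _)
    exact (mul_le_of_le_one_right (norm_nonneg _) (pow_le_one₀ hS.le (hS ▸ zero_le_one))).trans
      (hf.mul_haarDensity.norm_integral_mul_osc_le 0 ν m)
  · refine le_trans ?_ (le_max_left _ _)
    have hslope (z : ℂ) : 1 / 4 * (|2 * ν| + |(m : ℝ)|) ≤ ‖phaseSlope 0 ν m z‖ := by
      rw [phaseSlope, Complex.ofReal_zero, mul_zero, zero_mul, zero_add, norm_dual_half]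
      linarith [abs_add_abs_le_two_mul_sqrt (2 * ν) m]
    rw [← le_div_iff₀ (by positivity), div_eq_mul_inv, ← inv_pow]
    exact hC 0 _ ν m le_rfl hS.le hS fun z _ => hslope z

lemma exists_norm_mellinTransform_le (hf : IsTestFunction f) :
    ∃ K, ∀ (ν : ℝ) (m : ℤ),
      ‖mellinTransform f ν m‖ ≤ K * ((1 + ν ^ 2)⁻¹ * (1 + (m : ℝ) ^ 2)⁻¹) := by
  obtain ⟨C₀, hC₀⟩ := hf.exists_norm_mellinTransform_mul_pow_le 0
  obtain ⟨C₄, hC₄⟩ := hf.exists_norm_mellinTransform_mul_pow_le 4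
  refine ⟨2 * C₀ + 2 * C₄, fun ν m => ?_⟩
  rw [← mul_inv, ← div_eq_mul_inv, le_div_iff₀ (by positivity)]
  set S := |2 * ν| + |(m : ℝ)| with hS
  have hν : ν ^ 2 ≤ S ^ 2 := by
    rw [← sq_abs ν]
    gcongr
    rw [hS, abs_mul, abs_two]
    linarith [abs_nonneg ν, abs_nonneg (m : ℝ)]
  have hm : (m : ℝ) ^ 2 ≤ S ^ 2 := by
    rw [← sq_abs (m : ℝ)]
    gcongr
    exact le_add_of_nonneg_left (abs_nonneg _)
  calc ‖mellinTransform f ν m‖ * ((1 + ν ^ 2) * (1 + (m : ℝ) ^ 2))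
      ≤ ‖mellinTransform f ν m‖ * ((1 + S ^ 2) * (1 + S ^ 2)) := by gcongr
    _ ≤ ‖mellinTransform f ν m‖ * (2 * S ^ 0 + 2 * S ^ 4) := by
        gcongr
        linarith [sq_nonneg (S ^ 2 - 1)]
    _ = 2 * (‖mellinTransform f ν m‖ * S ^ 0) + 2 * (‖mellinTransform f ν m‖ * S ^ 4) := by ring
    _ ≤ 2 * C₀ + 2 * C₄ := by linarith [hC₀ ν m, hC₄ ν m]

lemma continuous_mellinTransform (hf : IsTestFunction f) (m : ℤ) :
    Continuous fun ν => mellinTransform f ν m := by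
  simp only [mellinTransform_eq_integral_osc]
  have hW := hf.mul_haarDensity
  refine continuous_of_dominated (fun ν => ?_) (fun ν => Eventually.of_forall fun z => ?_)
    (hW.contDiff.continuous.integrable_of_hasCompactSupport hW.hasCompactSupport).norm
    (Eventually.of_forall fun z => ?_)
  · exact (hW.integrable_mul fun z hz =>
      (contDiffAt_osc 0 ν m (hW.ne_zero_of_mem_tsupport hz)).continuousAt).aestronglyMeasurable
  · rcases eq_or_ne z 0 with rfl | hz
    · simp
    · rw [norm_mul, norm_osc 0 ν m hz, mul_one]
  · rcases eq_or_ne z 0 with rfl | hz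
    · simpa using continuous_const
    · simp only [osc_zero]
      exact continuous_const.mul (continuous_char m hz)

lemma integrable_mellinTransform (hf : IsTestFunction f) (m : ℤ) :
    Integrable fun ν => mellinTransform f ν m := by
  obtain ⟨K, hK⟩ := hf.exists_norm_mellinTransform_le
  exact ((integrable_inv_one_add_sq.mul_const _).const_mul K).mono'
    (hf.continuous_mellinTransform m).aestronglyMeasurable (Eventually.of_forall fun ν => hK ν m)

end IsTestFunction

lemma summable_inv_one_add_int_sq : Summable fun m : ℤ => (1 + (m : ℝ) ^ 2)⁻¹ := by
  refine ((Real.summable_one_div_int_pow (p := 2)).2 one_lt_two).of_norm_bounded_eventually ?_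
  filter_upwards [(finite_singleton (0 : ℤ)).compl_mem_cofinite] with m hm
  have hm₀ : (m : ℝ) ≠ 0 := Int.cast_ne_zero.2 hm
  rw [Real.norm_of_nonneg (by positivity), ← one_div]
  gcongr
  exact le_add_of_nonneg_left zero_le_one

lemma IsTestFunction.integrable_mellinTransform_mul_conj_char {f : ℂ → ℂ} (hf : IsTestFunction f)
    {z : ℂ} (hz : z ≠ 0) :
    Integrable (fun p : ℝ × ℤ => mellinTransform f p.1 p.2 * conj (char p.1 p.2 z))
      dualMeasure := by
  obtain ⟨K, hK⟩ := hf.exists_norm_mellinTransform_le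
  have hcount : Integrable (fun m : ℤ => (1 + (m : ℝ) ^ 2)⁻¹) Measure.count :=
    integrable_count_iff.2 summable_inv_one_add_int_sq.norm
  refine ((integrable_inv_one_add_sq.mul_prod hcount).const_mul K).mono' ?_
    (Eventually.of_forall fun p => ?_)
  · exact (measurable_from_prod_countable_left fun m =>
      ((hf.continuous_mellinTransform m).mul
        (Complex.continuous_conj.comp (continuous_char m hz))).measurable).aestronglyMeasurable
  · rw [norm_mul, Complex.norm_conj, norm_char _ _ hz, mul_one]
    exact hK p.1 p.2

end MellinDecay

section MellinInversion

/-- The angular Fourier coefficients of `f` on the circle of radius `r`. -/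
def angularCoeff (f : ℂ → ℂ) (m : ℤ) (r : ℝ) : ℂ :=
  ∫ θ in (-π)..π, f (r * Complex.exp (θ * I)) * Complex.exp (m * θ * I)

lemma continuous_angularCoeff {f : ℂ → ℂ} (hf : Continuous f) (m : ℤ) :
    Continuous (angularCoeff f m) :=
  intervalIntegral.continuous_parametric_intervalIntegral_of_continuous'
    ((hf.comp (by fun_prop)).mul (by fun_prop)) _ _

lemma norm_ofReal_mul_exp {r : ℝ} (hr : 0 < r) (θ : ℝ) : ‖(r : ℂ) * Complex.exp (θ * I)‖ = r := by
  rw [norm_mul, Complex.norm_exp_ofReal_mul_I, mul_one, Complex.norm_of_nonneg hr.le]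

lemma char_polar (ν : ℝ) (m : ℤ) {r : ℝ} (hr : 0 < r) (θ : ℝ) :
    char ν m (r * Complex.exp (θ * I)) = (r : ℂ) ^ (2 * I * ν) * Complex.exp (m * θ * I) := by
  rw [char, norm_ofReal_mul_exp hr, mul_div_cancel_left₀ _ (Complex.ofReal_ne_zero.2 hr.ne'),
    ← Complex.exp_int_mul, mul_assoc (m : ℂ)]

lemma conj_char_polar (ν : ℝ) (m : ℤ) {r : ℝ} (hr : 0 < r) (θ : ℝ) :
    conj (char ν m (r * Complex.exp (θ * I))) =
      (r : ℂ) ^ (-(2 * I * ν)) * Complex.exp (-(m * θ * I)) := by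
  have hr₀ : (r : ℂ) ≠ 0 := Complex.ofReal_ne_zero.2 hr.ne'
  rw [char_polar ν m hr, map_mul, Complex.cpow_def_of_ne_zero hr₀, Complex.cpow_def_of_ne_zero hr₀,
    ← Complex.exp_conj, ← Complex.exp_conj, ← Complex.ofReal_log hr.le]
  simp only [map_mul, Complex.conj_ofReal, Complex.conj_I, map_ofNat, map_intCast, mul_neg, neg_mul]

lemma hasSum_angularCoeff {f : ℂ → ℂ} (hf : Continuous f) {r : ℝ}
    (hsum : Summable fun m => angularCoeff f m r) (θ : ℝ) :
    HasSum (fun m : ℤ => 1 / (2 * π) * angularCoeff f m r * Complex.exp (-(m * θ * I)))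
      (f (r * Complex.exp (θ * I))) := by
  have : Fact (0 < 2 * π) := ⟨Real.two_pi_pos⟩
  have hπ : (π : ℂ) ≠ 0 := Complex.ofReal_ne_zero.2 Real.pi_ne_zero
  let g : C(AddCircle (2 * π), ℂ) :=
    ⟨fun x => f (r * (AddCircle.toCircle x : ℂ)), hf.comp
      (continuous_const.mul (continuous_subtype_val.comp AddCircle.continuous_toCircle))⟩
  have hg (x : ℝ) : g x = f (r * Complex.exp (x * I)) := by
    simp only [g, ContinuousMap.coe_mk, AddCircle.toCircle_apply_mk]
    rw [div_self Real.two_pi_pos.ne', one_mul, Circle.coe_exp]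
  have hmode (m : ℤ) (x : ℝ) :
      fourier m (x : AddCircle (2 * π)) = Complex.exp (m * x * I) := by
    rw [fourier_coe_apply]
    congr 1
    push_cast
    field_simp
  have hcoeff (m : ℤ) : fourierCoeff g (-m) = 1 / (2 * π) * angularCoeff f m r := by
    rw [fourierCoeff_eq_intervalIntegral g (-m) (-π), angularCoeff, Complex.real_smul,
      show -π + 2 * π = π by ring]
    simp only [neg_neg, hmode, hg, smul_eq_mul, mul_comm (Complex.exp _)]
    push_cast
    rfl
  have hsum' : Summable (fourierCoeff g) := by
    rw [← (Equiv.neg ℤ).summable_iff]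
    exact (hsum.mul_left (1 / (2 * π : ℂ))).congr fun m => (hcoeff m).symm
  have hseries := has_pointwise_sum_fourier_series_of_summable hsum' (θ : AddCircle (2 * π))
  rw [← (Equiv.neg ℤ).hasSum_iff, hg] at hseries
  refine hseries.congr_fun fun m => ?_
  simp only [Function.comp_def, Equiv.neg_apply, hcoeff, hmode, smul_eq_mul, Int.cast_neg, neg_mul]

namespace IsTestFunction

variable {f : ℂ → ℂ}

lemma integrableOn_polar (hf : IsTestFunction f) (s : ℂ) (m : ℤ) :
    IntegrableOn (fun p : ℝ × ℝ => (p.1 : ℂ) ^ (s - 1) *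
      (f (p.1 * Complex.exp (p.2 * I)) * Complex.exp (m * p.2 * I)))
      (Ioi 0 ×ˢ Ioo (-π) π) := by
  obtain ⟨a, b, ha, hab⟩ := hf.exists_norm_mem_Icc
  refine IntegrableOn.of_forall_sdiff_eq_zero (s := Icc a b ×ˢ Icc (-π) π) ?_
    (measurableSet_Ioi.prod measurableSet_Ioo) fun p hp => ?_
  · refine ContinuousOn.integrableOn_compact (isCompact_Icc.prod isCompact_Icc) fun p hp => ?_
    have hslit : (p.1 : ℂ) ∈ Complex.slitPlane :=
      Complex.ofReal_mem_slitPlane.2 (ha.trans_le hp.1.1)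
    have hpow : ContinuousAt (fun p : ℝ × ℝ => (p.1 : ℂ) ^ (s - 1)) p :=
      (Complex.continuous_ofReal.comp continuous_fst).continuousAt.cpow continuousAt_const hslit
    have hangular : Continuous fun p : ℝ × ℝ =>
        f (p.1 * Complex.exp (p.2 * I)) * Complex.exp (m * p.2 * I) :=
      (hf.contDiff.continuous.comp (by fun_prop)).mul (by fun_prop)
    exact (hpow.mul hangular.continuousAt).continuousWithinAt
  · have hzero : f (p.1 * Complex.exp (p.2 * I)) = 0 := by
      by_contra hne
      have hp₁ := hab _ hne
      rw [norm_ofReal_mul_exp hp.1.1] at hp₁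
      exact hp.2 ⟨hp₁, Ioo_subset_Icc_self hp.1.2⟩
    rw [hzero, zero_mul, mul_zero]

lemma integral_polar_angle (f : ℂ → ℂ) (s : ℂ) (m : ℤ) (r : ℝ) :
    ∫ θ in Ioo (-π) π, (r : ℂ) ^ (s - 1) *
      (f (r * Complex.exp (θ * I)) * Complex.exp (m * θ * I)) =
      (r : ℂ) ^ (s - 1) • angularCoeff f m r := by
  rw [integral_const_mul, ← integral_Ioc_eq_integral_Ioo,
    ← intervalIntegral.integral_of_le (by linarith [Real.pi_pos]), angularCoeff, smul_eq_mul]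

lemma mellinConvergent_angularCoeff (hf : IsTestFunction f) (s : ℂ) (m : ℤ) :
    MellinConvergent (angularCoeff f m) s := by
  have hint := hf.integrableOn_polar s m
  rw [IntegrableOn, Measure.volume_eq_prod, ← Measure.prod_restrict] at hint
  have hradial := hint.integral_prod_left
  simp only [integral_polar_angle] at hradial
  exact hradial

lemma mellinTransform_eq_mellin (hf : IsTestFunction f) (ν : ℝ) (m : ℤ) :
    mellinTransform f ν m = 2 * mellin (angularCoeff f m) (2 * I * ν) := by
  have hint := hf.integrableOn_polar (2 * I * ν) m
  rw [mellinTransform, ← Complex.integral_comp_polarCoord_symm, polarCoord_target]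
  calc _ = ∫ p in Ioi (0 : ℝ) ×ˢ Ioo (-π) π, 2 * ((p.1 : ℂ) ^ (2 * I * ν - 1) *
          (f (p.1 * Complex.exp (p.2 * I)) * Complex.exp (m * p.2 * I))) := by
        refine setIntegral_congr_fun (measurableSet_Ioi.prod measurableSet_Ioo) fun p hp => ?_
        have hp₀ : 0 < p.1 := hp.1
        have hp₁ : (p.1 : ℂ) ≠ 0 := Complex.ofReal_ne_zero.2 hp₀.ne'
        have hsymm : Complex.polarCoord.symm p = p.1 * Complex.exp (p.2 * I) := by
          rw [Complex.polarCoord_symm_apply, Complex.exp_mul_I, Complex.ofReal_cos,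
            Complex.ofReal_sin]
        simp only [hsymm, char_polar ν m hp₀, norm_ofReal_mul_exp hp₀]
        rw [Complex.cpow_sub _ _ hp₁, Complex.cpow_one, Complex.real_smul]
        push_cast
        field_simp
    _ = 2 * ∫ r in Ioi (0 : ℝ), ∫ θ in Ioo (-π) π, (r : ℂ) ^ (2 * I * ν - 1) *
          (f (r * Complex.exp (θ * I)) * Complex.exp (m * θ * I)) := by
        rw [integral_const_mul]
        rw [Measure.volume_eq_prod] at hint ⊢
        rw [setIntegral_prod _ hint]
    _ = 2 * mellin (angularCoeff f m) (2 * I * ν) := by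
        simp only [integral_polar_angle, mellin]

lemma integral_mellinTransform_mul_cpow (hf : IsTestFunction f) (m : ℤ) {r : ℝ} (hr : 0 < r) :
    ∫ ν : ℝ, mellinTransform f ν m * (r : ℂ) ^ (-(2 * I * ν)) = 2 * π * angularCoeff f m r := by
  have hmellin (y : ℝ) : mellin (angularCoeff f m) ((0 : ℝ) + y * I) =
      mellinTransform f (y / 2) m / 2 := by
    rw [hf.mellinTransform_eq_mellin, mul_div_cancel_left₀ _ two_ne_zero]
    push_cast
    ring_nf
  have hvertical : Complex.VerticalIntegrable (mellin (angularCoeff f m)) 0 := by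
    simp only [Complex.VerticalIntegrable, hmellin]
    exact ((hf.integrable_mellinTransform m).comp_div two_ne_zero).div_const 2
  have hinv := mellinInv_mellin_eq 0 (angularCoeff f m) hr (hf.mellinConvergent_angularCoeff _ m)
    hvertical (continuous_angularCoeff hf.contDiff.continuous m).continuousAt
  have hscale := Measure.integral_comp_div
    (fun ν : ℝ => mellinTransform f ν m * (r : ℂ) ^ (-(2 * I * ν))) 2
  calc ∫ ν : ℝ, mellinTransform f ν m * (r : ℂ) ^ (-(2 * I * ν))
      = 1 / 2 * ∫ y : ℝ, mellinTransform f (y / 2) m * (r : ℂ) ^ (-(2 * I * (y / 2 : ℝ))) := by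
        rw [hscale, abs_two, Complex.real_smul, Complex.ofReal_ofNat, ← mul_assoc,
          one_div_mul_cancel two_ne_zero, one_mul]
    _ = ∫ y : ℝ, (r : ℂ) ^ (-((0 : ℝ) + y * I)) • mellin (angularCoeff f m) ((0 : ℝ) + y * I) := by
        rw [← integral_const_mul]
        congr with y
        rw [hmellin, smul_eq_mul]
        push_cast
        ring_nf
    _ = 2 * π * angularCoeff f m r := by
        rw [← hinv, mellinInv, Complex.real_smul, Complex.ofReal_div, Complex.ofReal_mul,
          Complex.ofReal_one, Complex.ofReal_ofNat, ← mul_assoc, mul_one_div_cancel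
          (mul_ne_zero two_ne_zero (Complex.ofReal_ne_zero.2 Real.pi_ne_zero)), one_mul]

lemma integral_mellinTransform_mul_conj_char (hf : IsTestFunction f) (m : ℤ) {z : ℂ}
    (hz : z ≠ 0) :
    ∫ ν : ℝ, mellinTransform f ν m * conj (char ν m z) =
      2 * π * angularCoeff f m ‖z‖ * Complex.exp (-(m * z.arg * I)) := by
  have hr : 0 < ‖z‖ := norm_pos_iff.2 hz
  nth_rewrite 1 [← Complex.norm_mul_exp_arg_mul_I z]
  simp only [conj_char_polar _ _ hr, ← mul_assoc]
  rw [integral_mul_const, hf.integral_mellinTransform_mul_cpow m hr]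

theorem eq_integral_mellinTransform (hf : IsTestFunction f) {z : ℂ} (hz : z ≠ 0) :
    f z = 1 / (4 * π ^ 2) *
      ∫ p : ℝ × ℤ, mellinTransform f p.1 p.2 * conj (char p.1 p.2 z) ∂dualMeasure := by
  have hπ : (π : ℂ) ≠ 0 := Complex.ofReal_ne_zero.2 Real.pi_ne_zero
  have hint := hf.integrable_mellinTransform_mul_conj_char hz
  rw [dualMeasure] at hint ⊢
  have houter := hint.integral_prod_right
  simp only [hf.integral_mellinTransform_mul_conj_char _ hz] at houter
  have hsum : Summable fun m : ℤ => angularCoeff f m ‖z‖ := by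
    refine (((integrable_count_iff.1 houter).mul_left (1 / (2 * π))).congr fun m => ?_).of_norm
    have hmode : ‖Complex.exp (-(m * z.arg * I))‖ = 1 := by
      rw [show -(m * z.arg * I) = ((-(m * z.arg) : ℝ) : ℂ) * I by push_cast; ring,
        Complex.norm_exp_ofReal_mul_I]
    simp only [norm_mul, hmode, Complex.norm_ofNat, Complex.norm_of_nonneg Real.pi_pos.le]
    field_simp
  have hseries := hasSum_angularCoeff hf.contDiff.continuous hsum z.arg
  rw [integral_prod_symm _ hint]
  simp only [hf.integral_mellinTransform_mul_conj_char _ hz]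
  rw [integral_countable houter]
  simp only [measureReal_def, Measure.count_singleton, ENNReal.toReal_one, one_smul]
  rw [← Complex.norm_mul_exp_arg_mul_I z, ← hseries.tsum_eq, Complex.norm_mul_exp_arg_mul_I z,
    ← tsum_mul_left]
  congr with m
  field_simp
  ring

end IsTestFunction

end MellinInversion

section Localization

/-- The function `z ↦ v(|z|/R)` on `ℂˣ`, extended by zero to the plane, whatever `v 0` is. -/
def radialCutoff (v : ℝ → ℝ) (R : ℝ) : ℂ → ℂ := ({0}ᶜ : Set ℂ).indicator fun z => v (‖z‖ / R)

variable {v : ℝ → ℝ} {R : ℝ} {z : ℂ}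

lemma radialCutoff_of_ne_zero (hz : z ≠ 0) : radialCutoff v R z = v (‖z‖ / R) :=
  indicator_of_mem hz _

lemma radialCutoff_smul (hR : 0 < R) (z : ℂ) : radialCutoff v R (R • z) = radialCutoff v 1 z := by
  rcases eq_or_ne z 0 with rfl | hz
  · simp [radialCutoff]
  · rw [radialCutoff_of_ne_zero (smul_ne_zero hR.ne' hz), radialCutoff_of_ne_zero hz, norm_smul,
      Real.norm_of_nonneg hR.le, mul_div_cancel_left₀ _ hR.ne', div_one]

namespace IsCutoff

lemma tsupport_radialCutoff_subset (hv : IsCutoff v) (hR : 0 < R) :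
    tsupport (radialCutoff v R) ⊆ {z | ‖z‖ ∈ Icc (R / 3) (3 * R)} := by
  refine closure_minimal (fun z hz => ?_) (isClosed_Icc.preimage continuous_norm)
  have hz₀ : z ≠ 0 := fun h => hz (by simp [radialCutoff, h])
  have hpos : 0 < ‖z‖ / R := div_pos (norm_pos_iff.2 hz₀) hR
  rw [Function.mem_support, radialCutoff_of_ne_zero hz₀, Complex.ofReal_ne_zero] at hz
  constructor
  · by_contra! h
    exact hz (hv.eq_zero _ (Or.inl ⟨hpos, by rw [div_le_iff₀ hR]; linarith⟩))
  · by_contra! h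
    exact hz (hv.eq_zero _ (Or.inr ((le_div_iff₀ hR).2 h.le)))

lemma isTestFunction_radialCutoff (hv : IsCutoff v) (hR : 0 < R) :
    IsTestFunction (radialCutoff v R) where
  contDiff := contMDiff_iff_contDiff.1 <| contMDiff_of_tsupport fun z hz => by
    have hpos : 0 < ‖z‖ := (by positivity : 0 < R / 3).trans_le
      (hv.tsupport_radialCutoff_subset hR hz).1
    have hz₀ : z ≠ 0 := norm_pos_iff.1 hpos
    have hquot : ContDiffAt ℝ ∞ (fun w : ℂ => ‖w‖ / R) z := (contDiffAt_norm ℝ hz₀).div_const R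
    have hsmooth : ContDiffAt ℝ ∞ (fun w : ℂ => (v (‖w‖ / R) : ℂ)) z :=
      Complex.ofRealCLM.contDiff.contDiffAt.comp z
        ((hv.smooth.contDiffAt (Ioi_mem_nhds (div_pos hpos hR))).comp z hquot)
    refine (hsmooth.congr_of_eventuallyEq ?_).contMDiffAt
    filter_upwards [isOpen_ne.mem_nhds hz₀] with w hw using radialCutoff_of_ne_zero hw
  hasCompactSupport := (isCompact_closedBall 0 (3 * R)).of_isClosed_subset (isClosed_tsupport _)
    fun _ hz => mem_closedBall_zero_iff.2 (hv.tsupport_radialCutoff_subset hR hz).2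
  zero_notMem_tsupport h := by
    have := (hv.tsupport_radialCutoff_subset hR h).1
    rw [norm_zero] at this
    linarith

end IsCutoff

lemma contDiff_e_two_mul_re : ContDiff ℝ ∞ fun z : ℂ => e (2 * z.re) := by
  have hre : ContDiff ℝ ∞ fun z : ℂ => (z.re : ℂ) :=
    (Complex.ofRealCLM.comp Complex.reCLM).contDiff
  simp only [e, Complex.ofReal_mul]
  fun_prop

lemma xi_eq_mellinTransform (v : ℝ → ℝ) (R ν : ℝ) (m : ℤ) :
    xi v R ν m = 1 / (4 * π ^ 2) *
      mellinTransform (fun z => radialCutoff v R z * e (2 * z.re)) (ν / 2) m := by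
  rw [xi, mellinTransform, mellinTransform]
  push_cast
  congr 2 with z
  rcases eq_or_ne z 0 with rfl | hz
  · simp
  · rw [radialCutoff_of_ne_zero hz]

namespace IsCutoff

lemma integrable_xi_mul_conj_char (hv : IsCutoff v) (hR : 0 < R) (hz : z ≠ 0) :
    Integrable (fun p : ℝ × ℤ => xi v R (2 * p.1) p.2 * conj (char p.1 p.2 z)) dualMeasure := by
  simp only [xi_eq_mellinTransform, mul_div_cancel_left₀ _ (two_ne_zero (α := ℝ)), mul_assoc]
  exact (((hv.isTestFunction_radialCutoff hR).mul_contDiffAt fun _ _ =>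
    contDiff_e_two_mul_re.contDiffAt).integrable_mellinTransform_mul_conj_char hz).const_mul _

lemma e_two_mul_re_eq_integral_xi (hv : IsCutoff v) (hR : 0 < R)
    (hz : ‖z‖ ∈ Icc (R / 2) (2 * R)) :
    e (2 * z.re) = ∫ p : ℝ × ℤ, xi v R (2 * p.1) p.2 * conj (char p.1 p.2 z) ∂dualMeasure := by
  have hz₀ : z ≠ 0 := norm_pos_iff.1 ((by positivity : 0 < R / 2).trans_le hz.1)
  have hone : radialCutoff v R z = 1 := by
    rw [radialCutoff_of_ne_zero hz₀, hv.eq_one, Complex.ofReal_one]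
    rw [mem_Icc, le_div_iff₀ hR, div_le_iff₀ hR]
    exact ⟨by linarith [hz.1], hz.2⟩
  have hinv := ((hv.isTestFunction_radialCutoff hR).mul_contDiffAt fun _ _ =>
    contDiff_e_two_mul_re.contDiffAt).eq_integral_mellinTransform hz₀
  simp only [xi_eq_mellinTransform, mul_div_cancel_left₀ _ (two_ne_zero (α := ℝ)), mul_assoc,
    integral_const_mul]
  rwa [hone, one_mul] at hinv

end IsCutoff

end Localization

section Bounds

variable {v : ℝ → ℝ} {R : ℝ}

lemma char_smul (ν : ℝ) (m : ℤ) (hR : 0 < R) (z : ℂ) :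
    char ν m (R • z) = (R : ℂ) ^ (2 * I * ν) * char ν m z := by
  have hR₀ : (R : ℂ) ≠ 0 := Complex.ofReal_ne_zero.2 hR.ne'
  rw [char, char, norm_smul, Real.norm_of_nonneg hR.le, Complex.real_smul, Complex.ofReal_mul,
    Complex.mul_cpow_ofReal_nonneg hR.le (norm_nonneg z), mul_div_mul_left _ _ hR₀, mul_assoc]

lemma mellinTransform_eq_cpow_mul (f : ℂ → ℂ) (ν : ℝ) (m : ℤ) (hR : 0 < R) :
    mellinTransform f ν m =
      (R : ℂ) ^ (2 * I * ν) * mellinTransform (fun z => f (R • z)) ν m := by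
  have hR₀ : (R : ℂ) ≠ 0 := Complex.ofReal_ne_zero.2 hR.ne'
  have hscale := Measure.integral_comp_smul volume
    (fun z => f z * char ν m z * ((2 / ‖z‖ ^ 2 : ℝ) : ℂ)) R
  have hintegrand (z : ℂ) :
      (R : ℂ) ^ (2 * I * ν) * (f (R • z) * char ν m z * ((2 / ‖z‖ ^ 2 : ℝ) : ℂ)) =
        R ^ 2 * (f (R • z) * char ν m (R • z) * ((2 / ‖R • z‖ ^ 2 : ℝ) : ℂ)) := by
    rw [char_smul ν m hR, norm_smul, Real.norm_of_nonneg hR.le]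
    push_cast
    field_simp
  rw [mellinTransform, mellinTransform, ← integral_const_mul]
  simp only [hintegrand]
  rw [integral_const_mul, hscale, Complex.finrank_real_complex, abs_of_pos (by positivity),
    Complex.real_smul, ← mul_assoc]
  push_cast
  rw [mul_inv_cancel₀ (pow_ne_zero 2 hR₀), one_mul]

/-- The amplitude of `ξ_R` as an oscillatory integral, once `z` is rescaled by `R`. -/
def xiAmplitude (v : ℝ → ℝ) (z : ℂ) : ℂ := radialCutoff v 1 z * ((2 / ‖z‖ ^ 2 : ℝ) : ℂ)

lemma IsCutoff.isTestFunction_xiAmplitude (hv : IsCutoff v) : IsTestFunction (xiAmplitude v) :=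
  (hv.isTestFunction_radialCutoff one_pos).mul_haarDensity

lemma IsCutoff.norm_mem_Icc_of_mem_tsupport_xiAmplitude (hv : IsCutoff v) {z : ℂ}
    (hz : z ∈ tsupport (xiAmplitude v)) : ‖z‖ ∈ Icc (1 / 3) 3 := by
  simpa using hv.tsupport_radialCutoff_subset one_pos (tsupport_mul_subset_left hz)

lemma norm_xi_eq (v : ℝ → ℝ) (hR : 0 < R) (ν : ℝ) (m : ℤ) :
    ‖xi v R ν m‖ = 1 / (4 * π ^ 2) * ‖∫ z, xiAmplitude v z * osc R (ν / 2) m z‖ := by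
  have hunit : ‖(R : ℂ) ^ (2 * I * ((ν / 2 : ℝ) : ℂ))‖ = 1 := by
    rw [Complex.norm_cpow_eq_rpow_re_of_pos hR]
    simp
  rw [xi_eq_mellinTransform, norm_mul, mellinTransform_eq_cpow_mul _ _ _ hR, norm_mul, hunit,
    one_mul, mellinTransform]
  congr 2
  · simp [abs_of_pos Real.pi_pos]
  · congr with z
    rw [radialCutoff_smul hR, xiAmplitude, osc, Complex.smul_re, smul_eq_mul]
    ring

lemma le_norm_phaseSlope {ν : ℝ} {m : ℤ} {z : ℂ} (hR : 0 < R) (hz : ‖z‖ ∈ Icc (1 / 3) 3)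
    (h : √(ν ^ 2 + (m : ℝ) ^ 2) ∉ Icc (2 * π / 3 * R) (24 * π * R)) :
    1 / 10 * (R + |ν| + |(m : ℝ)|) ≤ ‖phaseSlope R (ν / 2) m z‖ := by
  have hlin : ‖2 * π * I * R * z‖ = 2 * π * R * ‖z‖ := by rw [norm_mul, norm_two_pi_I_mul hR.le]
  have hdual := norm_dual_half (ν / 2) m
  rw [mul_div_cancel₀ ν two_ne_zero] at hdual
  have habs := abs_add_abs_le_two_mul_sqrt ν m
  have hlower : 2 * π * R * (1 / 3) ≤ 2 * π * R * ‖z‖ := by gcongr; exact hz.1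
  have hupper : 2 * π * R * ‖z‖ ≤ 2 * π * R * 3 := by gcongr; exact hz.2
  have hπR : 3 * R ≤ π * R := by gcongr; exact Real.pi_gt_three.le
  rw [phaseSlope]
  rw [mem_Icc, not_and_or, not_le, not_le] at h
  rcases h with h | h
  · have := norm_sub_le_norm_add (2 * π * I * R * z) (I * (ν / 2 : ℝ) + m / 2)
    linarith
  · have := norm_sub_le_norm_add (I * (ν / 2 : ℝ) + m / 2) (2 * π * I * R * z)
    rw [add_comm (I * _ + _)] at this
    linarith

lemma norm_phaseSlope_le {ν : ℝ} {m : ℤ} {z : ℂ} (hR : 0 ≤ R) (hz : ‖z‖ ≤ 3)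
    (h : √(ν ^ 2 + (m : ℝ) ^ 2) ≤ 24 * π * R) :
    ‖phaseSlope R (ν / 2) m z‖ ≤ 18 * π * R := by
  have hdual := norm_dual_half (ν / 2) m
  rw [mul_div_cancel₀ ν two_ne_zero] at hdual
  calc _ ≤ ‖2 * π * I * R * z‖ + ‖I * (ν / 2 : ℝ) + m / 2‖ := norm_add_le _ _
    _ = 2 * π * R * ‖z‖ + √(ν ^ 2 + (m : ℝ) ^ 2) / 2 := by
        rw [norm_mul, norm_two_pi_I_mul hR, hdual]
    _ ≤ 2 * π * R * 3 + 24 * π * R / 2 := by gcongr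
    _ = 18 * π * R := by ring

lemma log_mul_add_one_le {a R₀ : ℝ} (ha : 0 ≤ a) (hR₀ : 1 < R₀) (hR : R₀ ≤ R) :
    Real.log (a * R + 1) ≤ (Real.log (a + 1) / Real.log R₀ + 1) * Real.log R := by
  have hR₁ : 1 < R := hR₀.trans_le hR
  have hlog₀ : 0 < Real.log R₀ := Real.log_pos hR₀
  have hlog : 1 ≤ Real.log R / Real.log R₀ :=
    (one_le_div hlog₀).2 (Real.log_le_log (by positivity) hR)
  calc Real.log (a * R + 1) ≤ Real.log ((a + 1) * R) :=
        Real.log_le_log (by positivity) (by linarith)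
    _ = Real.log (a + 1) * 1 + Real.log R := by
        rw [Real.log_mul (by positivity) (by positivity), mul_one]
    _ ≤ Real.log (a + 1) * (Real.log R / Real.log R₀) + Real.log R := by
        gcongr
        exact Real.log_nonneg (by linarith)
    _ = _ := by ring

namespace IsCutoff

theorem exists_norm_xi_le_rpow (hv : IsCutoff v) (A : ℝ) :
    ∃ C, ∀ R ν : ℝ, ∀ m : ℤ, 1 ≤ R →
      √(ν ^ 2 + (m : ℝ) ^ 2) ∉ Icc (2 * π / 3 * R) (24 * π * R) →
        ‖xi v R ν m‖ ≤ C * (R + |ν| + |(m : ℝ)|) ^ (-A) := by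
  obtain ⟨C, hC⟩ := hv.isTestFunction_xiAmplitude.exists_norm_integral_mul_osc_le_pow
    (c := 1 / 10) (by norm_num) ⌈A⌉₊
  refine ⟨1 / (4 * π ^ 2) * |C|, fun R ν m hR h => ?_⟩
  have hR₀ : 0 < R := by linarith
  have hRS : R ≤ R + |ν| + |(m : ℝ)| := by linarith [abs_nonneg ν, abs_nonneg (m : ℝ)]
  set S := R + |ν| + |(m : ℝ)|
  have hS : 0 < S := hR₀.trans_le hRS
  rw [norm_xi_eq v hR₀, mul_assoc]
  gcongr
  calc _ ≤ C * S⁻¹ ^ ⌈A⌉₊ := hC R S _ m hR₀.le hRS hS fun z hz =>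
        le_norm_phaseSlope hR₀ (hv.norm_mem_Icc_of_mem_tsupport_xiAmplitude hz) h
    _ ≤ |C| * S⁻¹ ^ ⌈A⌉₊ := by
        gcongr
        exact le_abs_self C
    _ ≤ |C| * S ^ (-A) := by
        rw [inv_pow, ← Real.rpow_natCast, ← Real.rpow_neg hS.le]
        gcongr
        · exact hR.trans hRS
        · exact Nat.le_ceil A

theorem exists_norm_xi_le_log (hv : IsCutoff v) {R₀ : ℝ} (hR₀ : 1 < R₀) :
    ∃ C, ∀ R ν : ℝ, ∀ m : ℤ, R₀ ≤ R → √(ν ^ 2 + (m : ℝ) ^ 2) ≤ 24 * π * R →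
      ‖xi v R ν m‖ ≤ C * (Real.log R / R) := by
  obtain ⟨C, hC₀, hC⟩ := hv.isTestFunction_xiAmplitude.exists_norm_integral_mul_osc_le_log
    (c := 18 * π) (by positivity)
  refine ⟨1 / (4 * π ^ 2) * (C * (Real.log ((18 * π) ^ 2 + 1) / Real.log R₀ + 1)),
    fun R ν m hR h => ?_⟩
  have hRpos : 0 < R := by linarith
  rw [norm_xi_eq v hRpos, mul_assoc, mul_assoc, ← mul_div_assoc (_ + 1)]
  gcongr
  refine (hC R _ m hRpos fun z hz =>
    norm_phaseSlope_le hRpos.le (hv.norm_mem_Icc_of_mem_tsupport_xiAmplitude hz).2 h).trans ?_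
  gcongr
  exact log_mul_add_one_le (by positivity) hR₀ hR

end IsCutoff

end Bounds

end ComplexMellin

end

theorem mainTheorem7 (v : ℝ → ℝ) (hv : ComplexMellin.IsCutoff v) :
    ∃ c₁ c₂ : ℝ, 0 < c₁ ∧ c₁ < c₂ ∧ ∀ R₀ : ℝ, 1 < R₀ →
      (∀ R : ℝ, R₀ ≤ R → ∀ z : ℂ, ‖z‖ ∈ Set.Icc (R / 2) (2 * R) →
        MeasureTheory.Integrable
          (fun p : ℝ × ℤ => ComplexMellin.xi v R (2 * p.1) p.2 *
            (starRingEnd ℂ) (ComplexMellin.char p.1 p.2 z)) ComplexMellin.dualMeasure ∧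
        ComplexMellin.e (2 * z.re) =
          ∫ p : ℝ × ℤ, ComplexMellin.xi v R (2 * p.1) p.2 *
            (starRingEnd ℂ) (ComplexMellin.char p.1 p.2 z) ∂ComplexMellin.dualMeasure) ∧
      (∀ A : ℝ, ∃ C : ℝ, ∀ R : ℝ, R₀ ≤ R → ∀ (ν : ℝ) (m : ℤ),
        Real.sqrt (ν ^ 2 + (m : ℝ) ^ 2) ∉ Set.Icc (c₁ * R) (c₂ * R) →
          ‖ComplexMellin.xi v R ν m‖ ≤ C * (R + |ν| + |(m : ℝ)|) ^ (-A)) ∧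
      (∃ C : ℝ, ∀ R : ℝ, R₀ ≤ R → ∀ (ν : ℝ) (m : ℤ),
        Real.sqrt (ν ^ 2 + (m : ℝ) ^ 2) ∈ Set.Icc (c₁ * R) (c₂ * R) →
          ‖ComplexMellin.xi v R ν m‖ ≤ C * (Real.log R / R)) := by
  have hπ := Real.pi_pos
  -- After rescaling by `R`, the phase is stationary at a point of modulus `√(ν² + m²) / (4πR)`.
  -- It lies in `1/3 ≤ |z| ≤ 3` for `√(ν² + m²)` from `4πR/3` to `12πR`; halve and double these.
  refine ⟨2 * Real.pi / 3, 24 * Real.pi, by positivity, by linarith, fun R₀ hR₀ =>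
    ⟨fun R hR z hz => ?_, fun A => ?_, ?_⟩⟩
  · have hR' : 0 < R := by linarith
    have hz₀ : z ≠ 0 := norm_pos_iff.1 (by linarith [hz.1])
    exact ⟨hv.integrable_xi_mul_conj_char hR' hz₀, hv.e_two_mul_re_eq_integral_xi hR' hz⟩
  · obtain ⟨C, hC⟩ := hv.exists_norm_xi_le_rpow A
    exact ⟨C, fun R hR ν m h => hC R ν m (hR₀.le.trans hR) h⟩
  · obtain ⟨C, hC⟩ := hv.exists_norm_xi_le_log hR₀
    exact ⟨C, fun R hR ν m h => hC R ν m hR h.2⟩
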